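/- Let $M$ be a (Hausdorff) smooth manifold of real dimension $\ell+2$ and let $\mathcal F$ be a transversely holomorphic foliation of complex codimension one on $M$: it is given by smooth foliated charts $(x,z)\in\mathbb R^\ell\times\mathbb C$ covering $M$, with leaves locally $z=\mathrm{const}$, and with locally biholomorphic changes $z'=g(z)$ of the transverse coordinate. A complex 1-form is transversely holomorphic (resp. transversely meromorphic) if in foliated charts it is $g(z)\,dz$ with $g$ holomorphic (resp. meromorphic); it defines $\mathcal F$ on an open set if it is holomorphic there and its kernel is $T\mathcal F$. Let $\Lambda\subset M$ be a finite union of compact leaves of $\mathcal F$, and suppose that for each leaf $L\subset\Lambda$ the holonomy group of $L$ contains an attractor, i.e. a germ of biholomorphism having the base point as an attracting (asymptotically stable) fixed point. Then: (1) (Extension) If $W$ is an open neighbourhood of $\Lambda$ and $\omega$ is a closed transversely holomorphic 1-form on $W\setminus\Lambda$ that defines $\mathcal F$ there, then $\omega$ extends to a transversely meromorphic 1-form on $W$ with simple poles and polar divisor $\Lambda$ (so each leaf of $\Lambda$ is a pole of order exactly one, and there are no other poles). (2) Suppose that $\mathcal F$ is $\mathbb C$-transversely additive on $M\setminus\Lambda$: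 there are an open cover $(U_i)$ of $M\setminus\Lambda$ and transversely holomorphic submersions $y_i\colon U_i\to\mathbb C$ such that $\mathcal F|_{U_i}$ is given by $dy_i=0$ and $y_i-y_j$ is locally constant on $U_i\cap U_j$. Then $\mathcal F$ is given by a closed transversely meromorphic 1-form $\omega$ on $M$ with simple poles and polar divisor $(\omega)_\infty=\Lambda$; that is, $\omega$ is closed and transversely holomorphic with kernel $T\mathcal F$ on $M\setminus\Lambda$, and has a pole of order exactly one along each leaf of $\Lambda$. Moreover $\omega$ can be chosen with $\omega|_{U_i}=dy_i$ for all $i$. -/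

import Mathlib

open Set Filter Topology unitInterval
open scoped Manifold ContDiff

/-- The model `ℝ^ℓ × ℂ` of a foliated chart `(x, z)`. -/
abbrev FolModel (ℓ : ℕ) : Type := EuclideanSpace ℝ (Fin ℓ) × ℂ

/-- A transversely holomorphic foliation of (complex) codimension one on a smooth manifold `M` of
real dimension `ℓ + 2`, given by an atlas of smooth foliated charts `e = (x, z) : U → ℝ^ℓ × ℂ`
such that the transverse coordinates change by holomorphic maps `z' = g(z)`
(locally biholomorphic, by symmetry in `e, e'`). -/
structure TransHolFoliation (ℓ : ℕ) (M : Type*) [TopologicalSpace M]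
    [ChartedSpace (EuclideanSpace ℝ (Fin (ℓ + 2))) M] where
  atlas : Set (OpenPartialHomeomorph M (FolModel ℓ))
  smooth : ∀ e ∈ atlas, ContMDiffOn (𝓡 (ℓ + 2)) 𝓘(ℝ, FolModel ℓ) ∞ e e.source
  smooth_symm : ∀ e ∈ atlas, ContMDiffOn 𝓘(ℝ, FolModel ℓ) (𝓡 (ℓ + 2)) ∞ e.symm e.target
  cover : ∀ p : M, ∃ e ∈ atlas, p ∈ e.source
  transition : ∀ e ∈ atlas, ∀ e' ∈ atlas, ∀ p ∈ e.source ∩ e'.source,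
    ∃ g : ℂ → ℂ, AnalyticAt ℂ g (e p).2 ∧ ∀ᶠ q in 𝓝 p, (e' q).2 = g (e q).2

/-- Complex-valued 1-forms on `M` (not necessarily continuous). A form on a subset of `M` is
represented by such an assignment whose values off that subset play no role. -/
abbrev ComplexOneForm (ℓ : ℕ) (M : Type*) [TopologicalSpace M]
    [ChartedSpace (EuclideanSpace ℝ (Fin (ℓ + 2))) M] : Type _ :=
  (p : M) → TangentSpace (𝓡 (ℓ + 2)) p →L[ℝ] ℂ

/-- The differential `df` of a function `f : M → ℂ`. -/
noncomputable def differential (ℓ : ℕ) {M : Type*} [TopologicalSpace M]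
    [ChartedSpace (EuclideanSpace ℝ (Fin (ℓ + 2))) M] (f : M → ℂ) : ComplexOneForm ℓ M :=
  fun p => mfderiv (𝓡 (ℓ + 2)) 𝓘(ℝ, ℂ) f p

/-- A map `h` fixing `z₀` is an attractor if `z₀` is an asymptotically stable fixed point:
`z₀` has arbitrarily small neighbourhoods `U` with `h(U) ⊆ U` on which the iterates of `h`
converge to `z₀`. This depends only on the germ of `h` at `z₀`. -/
def IsAttractor (h : ℂ → ℂ) (z₀ : ℂ) : Prop :=
  h z₀ = z₀ ∧ ∀ V ∈ 𝓝 z₀, ∃ U ∈ 𝓝 z₀, U ⊆ V ∧ MapsTo h U U ∧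
    ∀ z ∈ U, Tendsto (fun n : ℕ => h^[n] z) atTop (𝓝 z₀)

namespace TransHolFoliation

variable {ℓ : ℕ} {M : Type*} [TopologicalSpace M]
  [ChartedSpace (EuclideanSpace ℝ (Fin (ℓ + 2))) M]

/-! ### Leaves -/

/-- The leaf topology on `M`, generated by the open pieces `{x ∈ V, z = c}` of the level sets of
the transverse coordinates. -/
@[reducible]
def leafTopology (F : TransHolFoliation ℓ M) : TopologicalSpace M :=
  TopologicalSpace.generateFrom
    {S | ∃ e ∈ F.atlas, ∃ V : Set (EuclideanSpace ℝ (Fin ℓ)), IsOpen V ∧ ∃ c : ℂ,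
      S = e.source ∩ e ⁻¹' (V ×ˢ {c})}

/-- The leaves are the path components of the leaf topology. -/
def IsLeaf (F : TransHolFoliation ℓ M) (L : Set M) : Prop :=
  ∃ p : M, L = @pathComponent M F.leafTopology p

/-- A compact leaf: compact in the leaf topology (that is, as a manifold). -/
def IsCompactLeaf (F : TransHolFoliation ℓ M) (L : Set M) : Prop :=
  F.IsLeaf L ∧ @IsCompact M F.leafTopology L

/-- `Λ` is a finite union of compact leaves. -/
def IsFiniteUnionOfCompactLeaves (F : TransHolFoliation ℓ M) (Λ : Set M) : Prop :=
  ∃ S : Set (Set M), S.Finite ∧ (∀ L ∈ S, F.IsCompactLeaf L) ∧ Λ = ⋃₀ S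

/-- The tangent space `T_p F`, the common kernel of the differentials `dz` at `p`. -/
def tangent (F : TransHolFoliation ℓ M) (p : M) : Set (TangentSpace (𝓡 (ℓ + 2)) p) :=
  {v | ∀ e ∈ F.atlas, p ∈ e.source → differential ℓ (fun q => (e q).2) p v = 0}

/-! ### Holonomy -/

/-- Let `γ` be a path in a leaf and `e₀` a foliated chart at `γ 0`.
`F.HolonomyAlong γ e₀ t e h` says that `h` represents the holonomy germ of `γ` restricted to
`[0, t]`, from the transverse coordinate of `e₀` at `γ 0` to that of `e` at `γ t`: one moves along
`γ` inside a chart without changing the transverse coordinate and composes with the changes of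
transverse coordinate `z' = g(z)` when passing from one chart to the next. -/
inductive HolonomyAlong (F : TransHolFoliation ℓ M) (γ : I → M)
    (e₀ : OpenPartialHomeomorph M (FolModel ℓ)) :
    I → OpenPartialHomeomorph M (FolModel ℓ) → (ℂ → ℂ) → Prop
  | start : e₀ ∈ F.atlas → γ 0 ∈ e₀.source → HolonomyAlong F γ e₀ 0 e₀ id
  | slide {s t : I} {e : OpenPartialHomeomorph M (FolModel ℓ)} {h : ℂ → ℂ} :
      HolonomyAlong F γ e₀ s e h → s ≤ t → (∀ u ∈ Icc s t, γ u ∈ e.source) →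
      HolonomyAlong F γ e₀ t e h
  | change {t : I} {e e' : OpenPartialHomeomorph M (FolModel ℓ)} {h g : ℂ → ℂ} :
      HolonomyAlong F γ e₀ t e h → e' ∈ F.atlas → γ t ∈ e'.source →
      AnalyticAt ℂ g (e (γ t)).2 → (∀ᶠ q in 𝓝 (γ t), (e' q).2 = g (e q).2) →
      HolonomyAlong F γ e₀ t e' (g ∘ h)

/-- The (representatives of the germs in the) holonomy group of the leaf through `p`, written in
the transverse coordinate of the chart `e` at `p`: the holonomy germs of the loops at `p` in the
leaf. -/
def holonomyGroup (F : TransHolFoliation ℓ M) (e : OpenPartialHomeomorph M (FolModel ℓ)) (p : M) :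
    Set (ℂ → ℂ) :=
  {h | ∃ γ : I → M, @Continuous I M _ F.leafTopology γ ∧ γ 0 = p ∧ γ 1 = p ∧
    F.HolonomyAlong γ e 1 e h}

/-- The holonomy group of the leaf `L` contains an attractor. (The choice of the base point
and of the transverse coordinate changes the group only by a holomorphic conjugation.) -/
def HasAttractor (F : TransHolFoliation ℓ M) (L : Set M) : Prop :=
  ∃ p ∈ L, ∃ e ∈ F.atlas, p ∈ e.source ∧ ∃ h ∈ F.holonomyGroup e p, IsAttractor h (e p).2

/-! ### Transversely holomorphic functions, transversely holomorphic and meromorphic forms -/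

/-- Near `p` the function `f` is `g(z)` with `g` holomorphic. -/
def HolomorphicFunAt (F : TransHolFoliation ℓ M) (f : M → ℂ) (p : M) : Prop :=
  ∃ e ∈ F.atlas, p ∈ e.source ∧ ∃ g : ℂ → ℂ, AnalyticAt ℂ g (e p).2 ∧
    ∀ᶠ q in 𝓝 p, f q = g (e q).2

/-- Near `p` the form `θ` is `g(z) dz` with `g` holomorphic. -/
def HolomorphicAt (F : TransHolFoliation ℓ M) (θ : ComplexOneForm ℓ M) (p : M) : Prop :=
  ∃ e ∈ F.atlas, p ∈ e.source ∧ ∃ g : ℂ → ℂ, AnalyticAt ℂ g (e p).2 ∧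
    ∀ᶠ q in 𝓝 p, θ q = g (e q).2 • differential ℓ (fun q => (e q).2) q

/-- `θ` has a pole of order `k ≥ 1` along the leaf through `p`: near `p`, off the level set
`z = z(p)`, the form `θ` is `g(z) dz` with `g` meromorphic with a pole of order `k` at `z(p)`. -/
def HasPoleAt (F : TransHolFoliation ℓ M) (θ : ComplexOneForm ℓ M) (p : M) (k : ℕ) : Prop :=
  1 ≤ k ∧ ∃ e ∈ F.atlas, p ∈ e.source ∧ ∃ g : ℂ → ℂ, MeromorphicAt g (e p).2 ∧
    meromorphicOrderAt g (e p).2 = ((-(k : ℤ) : ℤ) : WithTop ℤ) ∧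
    ∀ᶠ q in 𝓝 p, (e q).2 ≠ (e p).2 →
      θ q = g (e q).2 • differential ℓ (fun q => (e q).2) q

/-- `θ` is a transversely holomorphic 1-form on `O`. -/
def HolomorphicOn (F : TransHolFoliation ℓ M) (θ : ComplexOneForm ℓ M) (O : Set M) : Prop :=
  ∀ p ∈ O, F.HolomorphicAt θ p

/-- `θ` is a transversely meromorphic 1-form on `O` (its values on the polar set play no role). -/
def MeromorphicFormOn (F : TransHolFoliation ℓ M) (θ : ComplexOneForm ℓ M) (O : Set M) : Prop :=
  ∀ p ∈ O, F.HolomorphicAt θ p ∨ ∃ k : ℕ, F.HasPoleAt θ p k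

/-- The polar set of `θ`. -/
def polarSet (F : TransHolFoliation ℓ M) (θ : ComplexOneForm ℓ M) : Set M :=
  {p | ∃ k : ℕ, F.HasPoleAt θ p k}

/-- The coordinate expression of `θ` in a foliated chart `e`, i.e. the pull-back of `θ` by
`e⁻¹`, as a differential form of degree one on `ℝ^ℓ × ℂ`. -/
noncomputable def inChart (θ : ComplexOneForm ℓ M) (e : OpenPartialHomeomorph M (FolModel ℓ)) :
    FolModel ℓ → (FolModel ℓ) [⋀^Fin 1]→L[ℝ] ℂ :=
  fun x => ContinuousAlternatingMap.ofSubsingleton ℝ (FolModel ℓ) ℂ (0 : Fin 1)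
    ((θ (e.symm x)).comp (mfderiv 𝓘(ℝ, FolModel ℓ) (𝓡 (ℓ + 2)) e.symm x))

/-- `θ` is differentiable and `dθ = 0` at the points of `O`. -/
def ClosedOn (F : TransHolFoliation ℓ M) (θ : ComplexOneForm ℓ M) (O : Set M) : Prop :=
  ∀ p ∈ O, ∀ e ∈ F.atlas, p ∈ e.source →
    DifferentiableAt ℝ (inChart θ e) (e p) ∧ extDeriv (inChart θ e) (e p) = 0

/-- `F` is given by `θ = 0` on `O`: the kernel of `θ` is the tangent space of `F`. -/
def DefinedBy (F : TransHolFoliation ℓ M) (θ : ComplexOneForm ℓ M) (O : Set M) : Prop :=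
  ∀ p ∈ O, {v | θ p v = 0} = F.tangent p

/-- `θ` is a closed transversely meromorphic 1-form on the open set `W`, with simple
poles and polar divisor `Λ` (every leaf of `Λ` with multiplicity one), that defines `F`. -/
structure LogarithmicOn (F : TransHolFoliation ℓ M) (θ : ComplexOneForm ℓ M) (W Λ : Set M) :
    Prop where
  meromorphic : F.MeromorphicFormOn θ W
  polarSet_eq : F.polarSet θ ∩ W = Λ
  simple : ∀ p ∈ Λ, F.HasPoleAt θ p 1
  closed : F.ClosedOn θ (W \ Λ)
  definedBy : F.DefinedBy θ (W \ Λ)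

/-- The `y i : U i → ℂ` are an atlas of a `ℂ`-additive transverse structure of `F` on `O`:
transversely holomorphic submersions with `F` given by `dy i = 0`, on an open cover of `O`, with
`y i = y j + a` on overlaps, `a` locally constant. -/
structure IsAdditiveAtlasOn (F : TransHolFoliation ℓ M) (O : Set M) {ι : Type*}
    (U : ι → Set M) (y : ι → M → ℂ) : Prop where
  isOpen : ∀ i, IsOpen (U i)
  cover : ⋃ i, U i = O
  holomorphic : ∀ i, ∀ p ∈ U i, F.HolomorphicFunAt (y i) p
  definedBy : ∀ i, F.DefinedBy (differential ℓ (y i)) (U i)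
  transition : ∀ i j, ∀ p ∈ U i ∩ U j, ∃ a : ℂ, ∀ᶠ q in 𝓝 p, y i q = y j q + a

end TransHolFoliation

set_option linter.unusedSectionVars false

/-! ### Attracting fixed points of holomorphic maps -/

/-! Compactness of the leaves makes `Λ` meet a small neighbourhood of `p` at most in the level set
`z = z(p)`. Off that level set the form is `f(z) dz`, with one coefficient `f` that is holomorphic
and zero-free on a punctured disc, possibly with an essential singularity at the centre. Continuing
`f` along loops in the leaf shows that `f(z) dz` is invariant under holonomy: `f(h(z)) h'(z) =
f(z)`.

For an attractor `h` fixing `z₀`, Cauchy's formula for the iterates gives `|h'(z₀)| < 1`, and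
`h'(z₀) ≠ 0` because `h` is a holonomy germ. Then `u = (z - z₀) f` satisfies `u ∘ h = k u` with
`k(z₀) = 1`. The factors of `k` along an orbit differ from 1 by geometrically decaying terms, so `u`
is bounded, and likewise `1/u`. Thus `u` extends holomorphically with a nonzero value at `z₀`, and
`f` has a simple pole (`meromorphicOrderAt_eq_neg_one_of_invariant`). The pole order is locally
constant along the leaf, so the whole leaf is a simple pole.

For an additive structure the `dy_i` glue to one form, closed because `d(f(z) dz) = f' dz ∧ dz = 0`,
and the extension statement applies to it. -/

theorem IsAttractor.norm_deriv_lt_one {h : ℂ → ℂ} {z₀ : ℂ} (hatt : IsAttractor h z₀)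
    (ha : AnalyticAt ℂ h z₀) : ‖deriv h z₀‖ < 1 := by
  obtain ⟨h0, hU⟩ := hatt
  -- Analyticity on `U` makes every iterate holomorphic there; the unit ball bounds all iterates
  -- uniformly.
  have hV : {z | AnalyticAt ℂ h z} ∩ Metric.ball z₀ 1 ∈ 𝓝 z₀ :=
    inter_mem ha.eventually_analyticAt (Metric.ball_mem_nhds _ one_pos)
  obtain ⟨U, hUn, hUV, hmaps, hlim⟩ := hU _ hV
  obtain ⟨r, hr, hball⟩ := Metric.nhds_basis_closedBall.mem_iff.1 hUn
  have hdiff (n : ℕ) : ∀ z ∈ U, DifferentiableAt ℂ h^[n] z := by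
    induction n with
    | zero => exact fun z _ => differentiableAt_id
    | succ n ih =>
      intro z hz
      rw [Function.iterate_succ']
      exact (hUV (hmaps.iterate n hz)).1.differentiableAt.comp z (ih z hz)
  have hder (n : ℕ) : deriv h^[n] z₀ = deriv h z₀ ^ n :=
    (HasDerivAt.iterate z₀ ha.differentiableAt.hasDerivAt h0 n).deriv
  -- Cauchy's formula for `(h^[n])'(z₀) = h'(z₀)^n`. The iterates tend boundedly to the constant
  -- `z₀` on the circle, so these powers tend to the derivative of a constant, which is 0.
  have hint (n : ℕ) : deriv h z₀ ^ n =
      (2 * Real.pi * Complex.I : ℂ)⁻¹ • ∮ z in C(z₀, r), (z - z₀) ^ (-2 : ℤ) • h^[n] z := by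
    have h1 : DifferentiableOn ℂ h^[n] (Metric.closedBall z₀ r) :=
      fun z hz => (hdiff n z (hball hz)).differentiableWithinAt
    have h2 : (∮ z in C(z₀, r), (z - z₀) ^ (-2 : ℤ) • h^[n] z) =
        (2 * Real.pi * Complex.I : ℂ) • deriv h^[n] z₀ := by
      rw [← h1.deriv_eq_smul_circleIntegral hr]
      congr 1 with z
      rw [one_div, zpow_neg]
      rfl
    rw [h2, hder, inv_smul_smul₀ Complex.two_pi_I_ne_zero]
  have hconv : Tendsto (fun n : ℕ => ∮ z in C(z₀, r), (z - z₀) ^ (-2 : ℤ) • h^[n] z) atTop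
      (𝓝 (∮ z in C(z₀, r), (z - z₀) ^ (-2 : ℤ) • z₀)) := by
    have hmem (θ : ℝ) : circleMap z₀ r θ ∈ U := hball (circleMap_mem_closedBall z₀ hr.le θ)
    refine intervalIntegral.tendsto_integral_filter_of_dominated_convergence
      (fun _ => |r| * (r ^ (-2 : ℤ) * (‖z₀‖ + 1))) ?_ ?_ (by simp) ?_
    · refine Eventually.of_forall fun n => Continuous.aestronglyMeasurable ?_
      have h1 : Continuous fun θ => h^[n] (circleMap z₀ r θ) := by
        refine continuous_iff_continuousAt.2 fun θ => ?_
        exact ContinuousAt.comp (f := circleMap z₀ r)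
          (hdiff n _ (hmem θ)).continuousAt (continuous_circleMap z₀ r).continuousAt
      have h2 : Continuous fun θ => (circleMap z₀ r θ - z₀) ^ (-2 : ℤ) := by
        refine ((continuous_circleMap z₀ r).sub continuous_const).zpow₀ _ fun θ => Or.inl ?_
        simpa using hr.ne'
      simp only [deriv_circleMap]
      exact ((continuous_circleMap 0 r).mul continuous_const).smul (h2.smul h1)
    · refine Eventually.of_forall fun n => Eventually.of_forall fun θ _ => ?_
      have h1 : h^[n] (circleMap z₀ r θ) ∈ Metric.ball z₀ 1 := (hUV (hmaps.iterate n (hmem θ))).2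
      have h2 : ‖h^[n] (circleMap z₀ r θ)‖ ≤ ‖z₀‖ + 1 := by
        have := norm_le_norm_add_norm_sub' (h^[n] (circleMap z₀ r θ)) z₀
        rw [mem_ball_iff_norm] at h1
        linarith
      simp only [deriv_circleMap, norm_smul, norm_mul, Complex.norm_I, mul_one, norm_zpow,
        norm_circleMap_zero, circleMap_sub_center, abs_of_pos hr]
      gcongr
    · refine Eventually.of_forall fun θ _ => ?_
      exact ((hlim _ (hmem θ)).const_smul _).const_smul _
  have hzero : (∮ z in C(z₀, r), (z - z₀) ^ (-2 : ℤ) • z₀) = 0 := by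
    have := circleIntegral.integral_sub_zpow_of_ne (n := -2) (by norm_num) z₀ z₀ r
    rw [circleIntegral.integral_smul_const, this, zero_smul]
  have hpow : Tendsto (fun n : ℕ => deriv h z₀ ^ n) atTop (𝓝 0) := by
    simp_rw [hint]
    rw [hzero] at hconv
    simpa using hconv.const_smul (2 * Real.pi * Complex.I : ℂ)⁻¹
  exact tendsto_pow_atTop_nhds_zero_iff_norm_lt_one.1 hpow

/-- A function on a punctured neighbourhood of an attracting fixed point which is multiplied by a
factor `1 + O(z)` under the dynamics is bounded. -/
theorem exists_eventually_norm_le_of_comp_eq_mul {h u k : ℂ → ℂ} {z₀ a : ℂ} {C : ℝ}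
    (h0 : h z₀ = z₀) (hd : HasStrictDerivAt h a z₀) (ha0 : a ≠ 0) (ha1 : ‖a‖ < 1)
    (hu : ∀ᶠ z in 𝓝[≠] z₀, ContinuousAt u z) (hk : ∀ᶠ z in 𝓝 z₀, ‖k z‖ ≤ 1 + C * ‖z - z₀‖)
    (hC : 0 ≤ C) (heq : ∀ᶠ z in 𝓝[≠] z₀, u (h z) = k z * u z) :
    ∃ B, ∀ᶠ z in 𝓝[≠] z₀, ‖u z‖ ≤ B := by
  obtain ⟨ρ, haρ, hρ1⟩ := exists_between ha1
  have hρ0 : 0 < ρ := (norm_nonneg a).trans_lt haρ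
  have hcontr : ∀ᶠ z in 𝓝 z₀, ‖h z - z₀‖ ≤ ρ * ‖z - z₀‖ := by
    have := hd.hasDerivAt.isLittleO.def (sub_pos.2 haρ)
    filter_upwards [this] with z hz
    rw [h0] at hz
    have h1 : ‖h z - z₀‖ ≤ ‖h z - z₀ - (z - z₀) • a‖ + ‖(z - z₀) • a‖ := by
      simpa using norm_add_le (h z - z₀ - (z - z₀) • a) ((z - z₀) • a)
    rw [norm_smul] at h1
    nlinarith
  rw [eventually_nhdsWithin_iff] at hu heq
  obtain ⟨r, hr, hball⟩ := Metric.nhds_basis_closedBall.mem_iff.1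
    (((hcontr.and hk).and hu).and heq)
  -- Since `a ≠ 0`, `h` is open at `z₀`: points of the `δ`-ball have preimages in the `r`-ball, so
  -- orbits can be followed backwards.
  have hsurj : h '' Metric.ball z₀ r ∈ 𝓝 z₀ := by
    have := hd.map_nhds_eq ha0
    rw [h0] at this
    rw [← this]
    exact image_mem_map (Metric.ball_mem_nhds _ hr)
  obtain ⟨δ, hδ, hδball⟩ := Metric.mem_nhds_iff.1 hsurj
  -- `K` solves `C + Kρ = K`, so the weight `exp(K|z - z₀|)` absorbs the factor `1 + C|z - z₀|` and
  -- `v` does not increase under `h`.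
  set K := C / (1 - ρ) with hK
  have hK0 : 0 ≤ K := div_nonneg hC (by linarith)
  have hKC : C = K * (1 - ρ) := by rw [hK, div_mul_cancel₀]; linarith
  set v : ℂ → ℝ := fun z => ‖u z‖ * Real.exp (K * ‖z - z₀‖) with hv
  have hdecr : ∀ w ∈ Metric.closedBall z₀ r, w ≠ z₀ → v (h w) ≤ v w := by
    intro w hw hw0
    obtain ⟨⟨⟨h1, h2⟩, h3⟩, h4⟩ := hball hw
    simp only [hv, h4 hw0, norm_mul]
    calc ‖k w‖ * ‖u w‖ * Real.exp (K * ‖h w - z₀‖)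
        ≤ Real.exp (C * ‖w - z₀‖) * ‖u w‖ * Real.exp (K * (ρ * ‖w - z₀‖)) := by
          gcongr
          exact h2.trans (by linarith [Real.add_one_le_exp (C * ‖w - z₀‖)])
      _ = ‖u w‖ * (Real.exp (C * ‖w - z₀‖) * Real.exp (K * (ρ * ‖w - z₀‖))) := by ring
      _ = ‖u w‖ * Real.exp (K * ‖w - z₀‖) := by
          rw [← Real.exp_add, hKC]; congr 2; ring
  have hcomp : IsCompact (Metric.closedBall z₀ r \ Metric.ball z₀ δ) :=
    (isCompact_closedBall z₀ r).diff Metric.isOpen_ball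
  have hvc : ContinuousOn v (Metric.closedBall z₀ r \ Metric.ball z₀ δ) := by
    intro w hw
    have hw0 : w ≠ z₀ := by
      rintro rfl
      exact hw.2 (Metric.mem_ball_self hδ)
    have hc : ContinuousAt u w := (hball hw.1).1.2 hw0
    exact (hc.norm.mul (by fun_prop)).continuousWithinAt
  obtain ⟨B, hB⟩ := hcomp.bddAbove_image hvc
  -- A point of the `δ`-ball is `h w` with `w` farther from `z₀` by a factor at least `1/ρ`, and `v
  -- (h w) ≤ v w`. After at most `n` backward steps the orbit reaches the compact annulus where `v ≤
  -- B`.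
  have hmain (n : ℕ) : ∀ z ∈ Metric.ball z₀ r, z ≠ z₀ → δ * ρ ^ n ≤ ‖z - z₀‖ → v z ≤ B := by
    induction n with
    | zero =>
      intro z hz _ hzn
      refine hB (mem_image_of_mem v ⟨Metric.ball_subset_closedBall hz, ?_⟩)
      simpa [dist_eq_norm] using hzn
    | succ n ih =>
      intro z hz hz0 hzn
      by_cases hzδ : z ∈ Metric.ball z₀ δ
      · obtain ⟨w, hw, rfl⟩ := hδball hzδ
        have hw0 : w ≠ z₀ := by
          rintro rfl
          exact hz0 h0
        have hw' := Metric.ball_subset_closedBall hw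
        refine (hdecr w hw' hw0).trans (ih w hw hw0 ?_)
        have h1 := hzn.trans (hball hw').1.1.1
        rw [pow_succ, ← mul_assoc, mul_comm] at h1
        exact le_of_mul_le_mul_left h1 hρ0
      · exact hB (mem_image_of_mem v ⟨Metric.ball_subset_closedBall hz, hzδ⟩)
  refine ⟨B, eventually_nhdsWithin_iff.2 ?_⟩
  filter_upwards [Metric.ball_mem_nhds z₀ hr] with z hz hz0
  have hpos : 0 < ‖z - z₀‖ := norm_pos_iff.2 (sub_ne_zero.2 hz0)
  obtain ⟨n, hn⟩ := exists_pow_lt_of_lt_one (div_pos hpos hδ) hρ1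
  rw [lt_div_iff₀ hδ, mul_comm] at hn
  refine le_trans ?_ (hmain n z hz hz0 hn.le)
  exact le_mul_of_one_le_right (norm_nonneg _) (Real.one_le_exp (by positivity))

/-- Supplies the growth bound on the multiplier, used for both `k` and `1/k`. -/
theorem exists_eventually_norm_le_one_add_mul {k : ℂ → ℂ} {z₀ : ℂ} (hk : DifferentiableAt ℂ k z₀)
    (h1 : k z₀ = 1) : ∃ C : ℝ, 0 ≤ C ∧ ∀ᶠ z in 𝓝 z₀, ‖k z‖ ≤ 1 + C * ‖z - z₀‖ := by
  obtain ⟨C, hC, hb⟩ := hk.isBigO_sub.exists_nonneg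
  refine ⟨C, hC, hb.bound.mono fun z hz => ?_⟩
  have := norm_le_norm_add_norm_sub' (k z) (k z₀)
  rw [h1, norm_one] at this
  rw [h1] at hz
  linarith

/-- A holomorphic form `f(z) dz` without zeros on a punctured neighbourhood, invariant under
a contraction, has a simple pole. -/
theorem meromorphicOrderAt_eq_neg_one_of_invariant {f h : ℂ → ℂ} {z₀ : ℂ}
    (hf : ∀ᶠ z in 𝓝[≠] z₀, AnalyticAt ℂ f z ∧ f z ≠ 0) (hh : AnalyticAt ℂ h z₀) (h0 : h z₀ = z₀)
    (hd0 : deriv h z₀ ≠ 0) (hd1 : ‖deriv h z₀‖ < 1)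
    (hinv : ∀ᶠ z in 𝓝[≠] z₀, f (h z) * deriv h z = f z) :
    MeromorphicAt f z₀ ∧ meromorphicOrderAt f z₀ = ((-1 : ℤ) : WithTop ℤ) := by
  set u : ℂ → ℂ := fun z => (z - z₀) * f z with hu
  set k : ℂ → ℂ := fun z => dslope h z₀ z / deriv h z with hk
  have hkan : DifferentiableAt ℂ k z₀ := by
    obtain ⟨p, hp⟩ := hh
    exact hp.has_fpower_series_dslope_fslope.analyticAt.differentiableAt.div
      hp.analyticAt.deriv.differentiableAt hd0
  have hk1 : k z₀ = 1 := by simp [hk, dslope_same, hd0]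
  have hdne : ∀ᶠ z in 𝓝[≠] z₀, deriv h z ≠ 0 :=
    (hh.deriv.continuousAt.eventually_ne hd0).filter_mono nhdsWithin_le_nhds
  have hne : ∀ᶠ z in 𝓝[≠] z₀, z ≠ z₀ := self_mem_nhdsWithin
  have heq : ∀ᶠ z in 𝓝[≠] z₀, u (h z) = k z * u z := by
    filter_upwards [hinv, hdne, hne] with z h1 h2 h3
    have h3' := sub_ne_zero.2 h3
    simp only [hu, hk, dslope_of_ne _ h3, slope_def_field, h0, ← h1]
    field_simp
  have huan : ∀ᶠ z in 𝓝[≠] z₀, AnalyticAt ℂ u z ∧ u z ≠ 0 := by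
    filter_upwards [hf, hne] with z h1 h3
    exact ⟨(analyticAt_id.sub analyticAt_const).mul h1.1, mul_ne_zero (sub_ne_zero.2 h3) h1.2⟩
  have hstrict := hh.hasStrictDerivAt
  obtain ⟨C, hC, hCb⟩ := exists_eventually_norm_le_one_add_mul hkan hk1
  obtain ⟨B, hB⟩ := exists_eventually_norm_le_of_comp_eq_mul h0 hstrict hd0 hd1
    (huan.mono fun z hz => hz.1.continuousAt) hCb hC heq
  -- `1/u` obeys the same functional equation with multiplier `1/k`; its bound keeps `u` away from
  -- 0.
  obtain ⟨C', hC', hCb'⟩ := exists_eventually_norm_le_one_add_mul (k := fun z => (k z)⁻¹)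
    (hkan.inv (by simp [hk1])) (by simp [hk1])
  obtain ⟨B', hB'⟩ := exists_eventually_norm_le_of_comp_eq_mul (u := fun z => (u z)⁻¹) h0 hstrict
    hd0 hd1 (huan.mono fun z hz => hz.1.continuousAt.inv₀ hz.2) hCb' hC'
    (heq.mono fun z hz => by simp only [hz, mul_inv])
  obtain ⟨s, hs, hsu⟩ := mem_nhdsWithin_iff_exists_mem_nhds_inter.1 (huan.and (hB.and hB'))
  have hana : AnalyticAt ℂ (Function.update u z₀ (limUnder (𝓝[≠] z₀) u)) z₀ := by
    refine (Complex.differentiableOn_update_limUnder_of_bddAbove hs ?_ ⟨B, ?_⟩).analyticAt hs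
    · exact fun z hz => (hsu hz).1.1.differentiableAt.differentiableWithinAt
    · rintro _ ⟨z, hz, rfl⟩
      exact (hsu hz).2.1
  set g := Function.update u z₀ (limUnder (𝓝[≠] z₀) u) with hg
  have hgu : ∀ z, z ≠ z₀ → g z = u z := fun z hz => Function.update_of_ne hz _ _
  have hg0 : g z₀ ≠ 0 := by
    intro hzero
    have ht : Tendsto (fun z => B' * ‖g z‖) (𝓝[≠] z₀) (𝓝 (B' * ‖g z₀‖)) :=
      (hana.continuousAt.norm.const_mul B').mono_left nhdsWithin_le_nhds
    rw [hzero, norm_zero, mul_zero] at ht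
    have hge : ∀ᶠ z in 𝓝[≠] z₀, (1 : ℝ) ≤ B' * ‖g z‖ := by
      filter_upwards [hne, hB', huan] with z h1 h2 h3
      rw [hgu z h1]
      have h4 : ‖(u z)⁻¹‖ * ‖u z‖ = 1 := by
        rw [← norm_mul, inv_mul_cancel₀ h3.2, norm_one]
      rw [← h4]
      gcongr
    exact absurd (ge_of_tendsto ht hge) (by norm_num)
  have hrep : ∀ᶠ z in 𝓝[≠] z₀, f z = (z - z₀) ^ (-1 : ℤ) • g z := by
    filter_upwards [hne] with z hz
    rw [hgu z hz, zpow_neg_one, smul_eq_mul, hu, inv_mul_cancel_left₀ (sub_ne_zero.2 hz)]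
  have hmer : MeromorphicAt f z₀ := by
    refine MeromorphicAt.congr ?_ (EventuallyEq.symm hrep)
    exact ((MeromorphicAt.id z₀).sub (MeromorphicAt.const z₀ z₀)).zpow (-1) |>.smul
      hana.meromorphicAt
  exact ⟨hmer, (meromorphicOrderAt_eq_int_iff hmer).2 ⟨g, hana, hg0, hrep⟩⟩

/-! ### Continuation along connected sets and paths -/

/-- Carries local constancy across plaques and along paths without subdividing them. -/
theorem IsPreconnected.prop_iff_of_eventually {X : Type*} [TopologicalSpace X] {s : Set X}
    (hs : IsPreconnected s) {P : X → Prop} (h : ∀ x ∈ s, ∀ᶠ y in 𝓝[s] x, P y ↔ P x)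
    {x y : X} (hx : x ∈ s) (hy : y ∈ s) : P x ↔ P y :=
  hs.induction₂ (fun x y => P x ↔ P y) (fun x hx => (h x hx).mono fun _ => Iff.symm)
    (fun _ _ _ _ _ _ h₁ h₂ => h₁.trans h₂) (fun _ _ _ _ h₁ => h₁.symm) hx hy

theorem Continuous.mem_pathComponent_zero {X : Type*} [TopologicalSpace X] {γ : I → X}
    (hγ : Continuous γ) (t : I) : γ t ∈ pathComponent (γ 0) :=
  have : PathConnectedSpace I := isPathConnected_iff_pathConnectedSpace.1
    ((convex_Icc (0 : ℝ) 1).isPathConnected ⟨0, by simp⟩)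
  (isPathConnected_range hγ).joinedIn _ (mem_range_self 0) _ (mem_range_self t) |>.joined

theorem Joined.exists_continuous {X : Type*} [TopologicalSpace X] {x y : X} (h : Joined x y) :
    ∃ γ : I → X, Continuous γ ∧ γ 0 = x ∧ γ 1 = y :=
  ⟨h.somePath, h.somePath.continuous, h.somePath.source, h.somePath.target⟩


namespace TransHolFoliation

variable {ℓ : ℕ} {M : Type*} [TopologicalSpace M]
  [ChartedSpace (EuclideanSpace ℝ (Fin (ℓ + 2))) M] {F : TransHolFoliation ℓ M}
  {e e' : OpenPartialHomeomorph M (FolModel ℓ)} {p q : M} {θ : ComplexOneForm ℓ M}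

/-! ### Transverse coordinates -/

/-- The differential `dz` of the transverse coordinate of `e`. -/
noncomputable abbrev dz (e : OpenPartialHomeomorph M (FolModel ℓ)) : ComplexOneForm ℓ M :=
  differential ℓ (fun q => (e q).2)

theorem mdifferentiableAt_chart (he : e ∈ F.atlas) (hp : p ∈ e.source) :
    MDifferentiableAt (𝓡 (ℓ + 2)) 𝓘(ℝ, FolModel ℓ) e p :=
  ((F.smooth e he).contMDiffAt (e.open_source.mem_nhds hp)).mdifferentiableAt (by simp)

theorem mdifferentiableAt_chart_symm (he : e ∈ F.atlas) {x : FolModel ℓ} (hx : x ∈ e.target) :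
    MDifferentiableAt 𝓘(ℝ, FolModel ℓ) (𝓡 (ℓ + 2)) e.symm x :=
  ((F.smooth_symm e he).contMDiffAt (e.open_target.mem_nhds hx)).mdifferentiableAt (by simp)

theorem mdifferentiableAt_transverse (he : e ∈ F.atlas) (hp : p ∈ e.source) :
    MDifferentiableAt (𝓡 (ℓ + 2)) 𝓘(ℝ, ℂ) (fun q => (e q).2) p := by
  have h : MDifferentiableAt 𝓘(ℝ, FolModel ℓ) 𝓘(ℝ, ℂ) (Prod.snd : FolModel ℓ → ℂ) (e p) :=
    differentiableAt_snd.mdifferentiableAt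
  exact h.comp p (mdifferentiableAt_chart he hp)

/-- Read in the chart, `dz` is a surjective projection; hence it vanishes nowhere and coefficients
of forms are unique. -/
theorem dz_comp_mfderiv_symm (he : e ∈ F.atlas) {x : FolModel ℓ} (hx : x ∈ e.target) :
    (dz e (e.symm x)).comp (mfderiv 𝓘(ℝ, FolModel ℓ) (𝓡 (ℓ + 2)) e.symm x) =
      ContinuousLinearMap.snd ℝ (EuclideanSpace ℝ (Fin ℓ)) ℂ := by
  have h1 := mfderiv_comp x (mdifferentiableAt_transverse he (e.map_target hx))
    (mdifferentiableAt_chart_symm he hx)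
  refine h1.symm.trans ?_
  have h2 : (fun q => (e q).2) ∘ e.symm =ᶠ[𝓝 x] Prod.snd := by
    filter_upwards [e.open_target.mem_nhds hx] with y hy
    simp [e.right_inv hy]
  rw [h2.mfderiv_eq, mfderiv_eq_fderiv]
  exact fderiv_snd

theorem exists_dz_eq_one (he : e ∈ F.atlas) (hp : p ∈ e.source) : ∃ v, dz e p v = 1 := by
  have h := dz_comp_mfderiv_symm he (e.map_source hp)
  have h2 := congrArg (fun L : FolModel ℓ →L[ℝ] ℂ => L (0, 1)) h
  rw [e.left_inv hp] at h2
  exact ⟨_, h2⟩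

theorem smul_dz_inj (he : e ∈ F.atlas) (hp : p ∈ e.source) {a b : ℂ}
    (h : a • dz e p = b • dz e p) : a = b := by
  obtain ⟨v, hv⟩ := exists_dz_eq_one he hp
  have := congrArg (fun L : TangentSpace (𝓡 (ℓ + 2)) p →L[ℝ] ℂ => L v) h
  simpa [hv] using this

theorem differential_eq_of_eventuallyEq {f : M → ℂ} {g : ℂ → ℂ} (he : e ∈ F.atlas)
    (hp : p ∈ e.source) (hg : DifferentiableAt ℂ g (e p).2) (h : ∀ᶠ q in 𝓝 p, f q = g (e q).2) :
    differential ℓ f p = deriv g (e p).2 • dz e p := by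
  have h1 : f =ᶠ[𝓝 p] g ∘ fun q => (e q).2 := h
  have h2 : HasFDerivAt g ((ContinuousLinearMap.toSpanSingleton ℂ (deriv g (e p).2)).restrictScalars ℝ)
    (e p).2 := hg.hasDerivAt.hasFDerivAt.restrictScalars ℝ
  have h3 := mfderiv_comp p h2.differentiableAt.mdifferentiableAt (mdifferentiableAt_transverse he hp)
  unfold differential
  rw [h1.mfderiv_eq, h3, mfderiv_eq_fderiv, h2.fderiv]
  ext v
  change dz e p v * deriv g (e p).2 = deriv g (e p).2 * dz e p v
  exact mul_comm _ _

/-- Continuity and openness of `z` in one equality, so that local statements pass between `M` and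
`ℂ` in both directions. -/
theorem map_transverse_nhds (hp : p ∈ e.source) :
    map (fun q => (e q).2) (𝓝 p) = 𝓝 (e p).2 := by
  have : (fun q => (e q).2) = Prod.snd ∘ e := rfl
  rw [this, ← Filter.map_map, e.map_nhds_eq hp, map_snd_nhds]

theorem continuousAt_transverse (hp : p ∈ e.source) : ContinuousAt (fun q => (e q).2) p :=
  (map_transverse_nhds hp).le

theorem eventually_transverse_iff (hp : p ∈ e.source) {P : ℂ → Prop} :
    (∀ᶠ q in 𝓝 p, P (e q).2) ↔ ∀ᶠ c in 𝓝 (e p).2, P c := by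
  rw [← map_transverse_nhds hp]; rfl

/-- The relation `dz' = g'(z) dz` with `dz' ≠ 0` suffices; no inverse of `g` is needed. -/
theorem deriv_transition_ne_zero (he : e ∈ F.atlas) (he' : e' ∈ F.atlas) (hp : p ∈ e.source)
    (hp' : p ∈ e'.source) {g : ℂ → ℂ} (hg : AnalyticAt ℂ g (e p).2)
    (h : ∀ᶠ q in 𝓝 p, (e' q).2 = g (e q).2) : deriv g (e p).2 ≠ 0 := by
  intro h0
  have h1 : dz e' p = _ := differential_eq_of_eventuallyEq he hp hg.differentiableAt h
  obtain ⟨v, hv⟩ := exists_dz_eq_one he' hp'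
  rw [h1, h0] at hv
  simp at hv

/-! ### Coefficients of transversely holomorphic forms -/

theorem HolomorphicAt.exists_coeff (hθ : F.HolomorphicAt θ p) (he : e ∈ F.atlas)
    (hp : p ∈ e.source) : ∃ f : ℂ → ℂ, AnalyticAt ℂ f (e p).2 ∧
      ∀ᶠ q in 𝓝 p, θ q = f (e q).2 • dz e q := by
  obtain ⟨e', he', hp', f, hf, hθ⟩ := hθ
  obtain ⟨g, hg, hgz⟩ := F.transition e he e' he' p ⟨hp, hp'⟩
  have hpz : (e' p).2 = g (e p).2 := hgz.self_of_nhds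
  refine ⟨fun c => f (g c) * deriv g c, ?_, ?_⟩
  · exact (AnalyticAt.fun_comp (hpz ▸ hf) hg).mul hg.deriv
  · filter_upwards [hθ, hgz.eventually_nhds, e.open_source.mem_nhds hp,
      (eventually_transverse_iff hp).2 hg.eventually_analyticAt] with q h1 h2 h3 h4
    rw [h1, ← h2.self_of_nhds, mul_smul, ← differential_eq_of_eventuallyEq he h3 h4.differentiableAt h2]

theorem HolomorphicFunAt.holomorphicAt_differential {y : M → ℂ} (hy : F.HolomorphicFunAt y p) :
    F.HolomorphicAt (differential ℓ y) p := by
  obtain ⟨e, he, hp, g, hg, h⟩ := hy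
  refine ⟨e, he, hp, deriv g, hg.deriv, ?_⟩
  filter_upwards [h.eventually_nhds, e.open_source.mem_nhds hp,
    (eventually_transverse_iff hp).2 hg.eventually_analyticAt] with q h2 h3 h4
  exact differential_eq_of_eventuallyEq he h3 h4.differentiableAt h2

theorem HolomorphicAt.congr {θ' : ComplexOneForm ℓ M} (hθ : F.HolomorphicAt θ p)
    (h : ∀ᶠ q in 𝓝 p, θ' q = θ q) : F.HolomorphicAt θ' p := by
  obtain ⟨e, he, hp, g, hg, h'⟩ := hθ
  exact ⟨e, he, hp, g, hg, (h.and h').mono fun q hq => hq.1.trans hq.2⟩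

/-- In the chart the form is `f(z) dz`, whose exterior derivative is `f'(z) dz ∧ dz = 0`. -/
theorem HolomorphicOn.closedOn {O : Set M} (hθ : F.HolomorphicOn θ O) : F.ClosedOn θ O := by
  intro p hpO e he hp
  obtain ⟨f, hf, hθf⟩ := (hθ p hpO).exists_coeff he hp
  let Φ : (FolModel ℓ →L[ℝ] ℂ) ≃ₗᵢ[ℝ] (FolModel ℓ [⋀^Fin 1]→L[ℝ] ℂ) :=
    ContinuousAlternatingMap.ofSubsingletonLIE 0
  set β : FolModel ℓ → (FolModel ℓ) [⋀^Fin 1]→L[ℝ] ℂ := fun x =>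
    Φ (f x.2 • ContinuousLinearMap.snd ℝ (EuclideanSpace ℝ (Fin ℓ)) ℂ)
    with hβ
  have heq : inChart θ e =ᶠ[𝓝 (e p)] β := by
    have h1 : ∀ᶠ x in 𝓝 (e p), θ (e.symm x) = f (e (e.symm x)).2 • dz e (e.symm x) := by
      have := e.symm.continuousAt (x := e p) (e.map_source hp)
      rw [ContinuousAt, e.left_inv hp] at this
      exact this.eventually hθf
    filter_upwards [h1, e.open_target.mem_nhds (e.map_source hp)] with x h2 h3
    rw [e.right_inv h3] at h2
    simp only [inChart, hβ, h2]
    rw [← dz_comp_mfderiv_symm he h3]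
    rfl
  have hfd : HasFDerivAt (fun x : FolModel ℓ => f x.2)
      (((ContinuousLinearMap.toSpanSingleton ℂ (deriv f (e p).2)).restrictScalars ℝ).comp
        (ContinuousLinearMap.snd ℝ (EuclideanSpace ℝ (Fin ℓ)) ℂ)) (e p) :=
    (hf.differentiableAt.hasDerivAt.hasFDerivAt.restrictScalars ℝ).comp (e p) hasFDerivAt_snd
  have hβd : DifferentiableAt ℝ β (e p) :=
    Φ.toContinuousLinearEquiv.differentiableAt.comp (e p) (hfd.differentiableAt.smul_const _)
  refine ⟨hβd.congr_of_eventuallyEq heq, ?_⟩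
  rw [heq.extDeriv_eq]
  ext v
  have hev (w : Fin 1 → FolModel ℓ) (v : FolModel ℓ) :
      fderiv ℝ (fun x => β x w) (e p) v = deriv f (e p).2 * v.2 * (w 0).2 := by
    have h1 : (fun x => β x w) = fun x => f x.2 * (w 0).2 := rfl
    rw [h1, (hfd.mul_const (w 0).2).fderiv]
    simp [mul_comm, mul_left_comm]
  rw [extDeriv_apply hβd, Fin.sum_univ_two, hev, hev]
  simp [Fin.removeNth]
  ring

end TransHolFoliation

namespace TransHolFoliation

variable {ℓ : ℕ} {M : Type*} [TopologicalSpace M]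
  [ChartedSpace (EuclideanSpace ℝ (Fin (ℓ + 2))) M] {F : TransHolFoliation ℓ M}
  {e e' : OpenPartialHomeomorph M (FolModel ℓ)} {p q : M} {θ : ComplexOneForm ℓ M}

/-! ### Coefficients off a level set and their pole orders -/

theorem DefinedBy.coeff_ne_zero {O : Set M} (hθ : F.DefinedBy θ O) (hpO : p ∈ O)
    (he : e ∈ F.atlas) (hp : p ∈ e.source) {a : ℂ} (h : θ p = a • dz e p) : a ≠ 0 := by
  rintro rfl
  obtain ⟨v, hv⟩ := exists_dz_eq_one he hp
  have hmem : v ∈ {v | θ p v = 0} := by simp [h]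
  rw [hθ p hpO] at hmem
  exact one_ne_zero (hv.symm.trans (hmem e he hp))

/-- Near `p`, off the level set `z = z(p)`, the form `θ` is `f(z) dz` in the chart `e`. -/
def HasCoeff (θ : ComplexOneForm ℓ M) (p : M) (e : OpenPartialHomeomorph M (FolModel ℓ))
    (f : ℂ → ℂ) : Prop :=
  ∀ᶠ q in 𝓝 p, (e q).2 ≠ (e p).2 → θ q = f (e q).2 • dz e q

/-- In a box, the coefficient is locally independent of `x`, and for fixed `z` the plaque is a ball,
hence connected. So it depends on `z` alone. Uniqueness of the value at each point excludes
monodromy around the puncture. -/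
theorem exists_hasCoeff {O : Set M} (hθ : F.HolomorphicOn θ O) (hdef : F.DefinedBy θ O)
    (he : e ∈ F.atlas) (hp : p ∈ e.source) (hO : ∀ᶠ q in 𝓝 p, (e q).2 ≠ (e p).2 → q ∈ O) :
    ∃ f : ℂ → ℂ, HasCoeff θ p e f ∧
      ∀ᶠ c in 𝓝[≠] (e p).2, AnalyticAt ℂ f c ∧ f c ≠ 0 := by
  have hsymm := e.symm.continuousAt (x := e p) (e.map_source hp)
  rw [ContinuousAt, e.left_inv hp] at hsymm
  obtain ⟨r, hr, hbox⟩ := Metric.mem_nhds_iff.1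
    (inter_mem (e.open_target.mem_nhds (e.map_source hp)) (hsymm hO))
  rw [show e p = ((e p).1, (e p).2) from rfl, ← ball_prod_same] at hbox
  have hbox' : ∀ x : FolModel ℓ, x.1 ∈ Metric.ball (e p).1 r → x.2 ∈ Metric.ball (e p).2 r →
      x.2 ≠ (e p).2 → x ∈ e.target ∧ e.symm x ∈ O := by
    intro x h1 h2 h3
    obtain ⟨h4, h5⟩ := hbox (mk_mem_prod h1 h2)
    replace h5 : (e (e.symm x)).2 ≠ (e p).2 → e.symm x ∈ O := h5
    rw [e.right_inv h4] at h5
    exact ⟨h4, h5 h3⟩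
  have hloc : ∀ x : FolModel ℓ, ∃ f : ℂ → ℂ, x.1 ∈ Metric.ball (e p).1 r →
      x.2 ∈ Metric.ball (e p).2 r → x.2 ≠ (e p).2 → AnalyticAt ℂ f x.2 ∧
        ∀ᶠ y in 𝓝 x, θ (e.symm y) = f y.2 • dz e (e.symm y) := by
    intro x
    by_cases hx : x.1 ∈ Metric.ball (e p).1 r ∧ x.2 ∈ Metric.ball (e p).2 r ∧ x.2 ≠ (e p).2
    · obtain ⟨h1, h2⟩ := hbox' x hx.1 hx.2.1 hx.2.2
      obtain ⟨f, hf, hfθ⟩ := (hθ _ h2).exists_coeff he (e.map_target h1)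
      rw [e.right_inv h1] at hf
      refine ⟨f, fun _ _ _ => ⟨hf, ?_⟩⟩
      filter_upwards [(e.symm.continuousAt h1).eventually hfθ, e.open_target.mem_nhds h1]
        with y h3 h4
      rwa [e.right_inv h4] at h3
    · exact ⟨0, fun h1 h2 h3 => absurd ⟨h1, h2, h3⟩ hx⟩
  -- One local coefficient per point `x`; only its germ at `x.2` matters, and it is 0 outside the
  -- punctured box.
  choose f hf using hloc
  have hA : ∀ x : FolModel ℓ, x.1 ∈ Metric.ball (e p).1 r → x.2 ∈ Metric.ball (e p).2 r →
      x.2 ≠ (e p).2 → ∀ᶠ y in 𝓝 x, f y y.2 = f x y.2 := by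
    intro x h1 h2 h3
    have hn : {y : FolModel ℓ | y.1 ∈ Metric.ball (e p).1 r ∧ y.2 ∈ Metric.ball (e p).2 r ∧
        y.2 ≠ (e p).2} ∈ 𝓝 x := by
      refine inter_mem ?_ (inter_mem ?_ ?_)
      · exact continuous_fst.continuousAt (Metric.isOpen_ball.mem_nhds h1)
      · exact continuous_snd.continuousAt (Metric.isOpen_ball.mem_nhds h2)
      · exact continuous_snd.continuousAt.eventually_ne h3
    filter_upwards [hn, (hf x h1 h2 h3).2] with y h4 h5
    have h6 := (hf y h4.1 h4.2.1 h4.2.2).2.self_of_nhds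
    exact smul_dz_inj he (e.map_target (hbox' y h4.1 h4.2.1 h4.2.2).1) (h6.symm.trans h5)
  have hconst : ∀ x : FolModel ℓ, x.1 ∈ Metric.ball (e p).1 r → x.2 ∈ Metric.ball (e p).2 r →
      x.2 ≠ (e p).2 → f x x.2 = f ((e p).1, x.2) x.2 := by
    rintro ⟨a, c⟩ h1 h2 h3
    refine ((convex_ball (e p).1 r).isPreconnected.prop_iff_of_eventually
      (P := fun b => f (b, c) c = f ((e p).1, c) c) ?_ (Metric.mem_ball_self hr) h1).1 rfl
    intro b hb
    have hcont : ContinuousAt (fun b' : EuclideanSpace ℝ (Fin ℓ) => (b', c)) b := by fun_prop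
    refine nhdsWithin_le_nhds ((hcont.eventually (hA (b, c) hb h2 h3)).mono fun b' hb' => ?_)
    simp only at hb' ⊢
    rw [hb']
  refine ⟨fun c => f ((e p).1, c) c, ?_, ?_⟩
  · have hpr : Metric.ball (e p).1 r ×ˢ Metric.ball (e p).2 r ∈ 𝓝 (e p) :=
      prod_mem_nhds (Metric.ball_mem_nhds _ hr) (Metric.ball_mem_nhds _ hr)
    filter_upwards [(e.continuousAt hp) hpr, e.open_source.mem_nhds hp] with q h1 h2 h3
    have h4 := (hf (e q) h1.1 h1.2 h3).2.self_of_nhds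
    rw [e.left_inv h2] at h4
    rw [h4, hconst (e q) h1.1 h1.2 h3]
  · rw [eventually_nhdsWithin_iff]
    filter_upwards [Metric.ball_mem_nhds (e p).2 hr] with c hc hc0
    have hx : ((e p).1, c).1 ∈ Metric.ball (e p).1 r := Metric.mem_ball_self hr
    obtain ⟨h1, h2⟩ := hf ((e p).1, c) hx hc hc0
    have h3 := hbox' ((e p).1, c) hx hc hc0
    refine ⟨h1.congr ?_, hdef.coeff_ne_zero h3.2 he (e.map_target h3.1) h2.self_of_nhds⟩
    have hcont : ContinuousAt (fun c' : ℂ => ((e p).1, c')) c := by fun_prop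
    exact (hcont.eventually (hA ((e p).1, c) hx hc hc0)).mono fun c' h => h.symm

theorem HasCoeff.eventuallyEq {f f' : ℂ → ℂ} (h : HasCoeff θ p e f) (h' : HasCoeff θ p e f')
    (he : e ∈ F.atlas) (hp : p ∈ e.source) : f =ᶠ[𝓝[≠] (e p).2] f' := by
  refine eventually_nhdsWithin_iff.2 ((eventually_transverse_iff (e := e) hp).1 ?_)
  filter_upwards [h, h', e.open_source.mem_nhds hp] with q h1 h2 h3 h4
  exact smul_dz_inj he h3 ((h1 h4).symm.trans (h2 h4))

theorem HasCoeff.congr {f f' : ℂ → ℂ} (h : HasCoeff θ p e f) (hp : p ∈ e.source)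
    (hff' : f =ᶠ[𝓝[≠] (e p).2] f') : HasCoeff θ p e f' := by
  filter_upwards [h, (eventually_transverse_iff hp).2 (eventually_nhdsWithin_iff.1 hff')]
    with q h1 h2 h3
  rw [h1 h3, h2 h3]

theorem HasCoeff.eventually_of_transverse_eq {f : ℂ → ℂ} (h : HasCoeff θ p e f) :
    ∀ᶠ q in 𝓝 p, (e q).2 = (e p).2 → HasCoeff θ q e f :=
  h.eventually_nhds.mono fun q hq hqp => by rwa [HasCoeff, hqp]

theorem HasCoeff.change {f g : ℂ → ℂ} (h : HasCoeff θ p e' f) (he : e ∈ F.atlas)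
    (he' : e' ∈ F.atlas) (hp : p ∈ e.source) (hp' : p ∈ e'.source) (hg : AnalyticAt ℂ g (e p).2)
    (hgz : ∀ᶠ q in 𝓝 p, (e' q).2 = g (e q).2) :
    HasCoeff θ p e (fun c => f (g c) * deriv g c) := by
  have hd := deriv_transition_ne_zero he he' hp hp' hg hgz
  -- As `g' ≠ 0`, leaving the level set of `e` also leaves that of `e'`, where the coefficient `f`
  -- is valid.
  have hne := eventually_nhdsWithin_iff.1
    (hg.differentiableAt.hasDerivAt.eventually_ne (c := g (e p).2) hd)
  filter_upwards [h, hgz.eventually_nhds, e.open_source.mem_nhds hp,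
    (eventually_transverse_iff hp).2 hg.eventually_analyticAt,
    (eventually_transverse_iff hp).2 hne] with q h1 h2 h3 h4 h5 h6
  rw [h2.self_of_nhds, hgz.self_of_nhds] at h1
  rw [h1 (h5 h6), mul_smul, ← differential_eq_of_eventuallyEq he h3 h4.differentiableAt h2]

/-- The pole order does not depend on the chart: composition with `g`, where `g' ≠ 0`, preserves the
meromorphic order, and the factor `g'` has order 0. -/
theorem HasCoeff.hasPoleAt_iff {f : ℂ → ℂ} (h : HasCoeff θ p e f) (he : e ∈ F.atlas)
    (hp : p ∈ e.source) {k : ℕ} : F.HasPoleAt θ p k ↔ 1 ≤ k ∧ MeromorphicAt f (e p).2 ∧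
      meromorphicOrderAt f (e p).2 = ((-(k : ℤ) : ℤ) : WithTop ℤ) := by
  refine ⟨?_, fun ⟨h1, h2, h3⟩ => ⟨h1, e, he, hp, f, h2, h3, h⟩⟩
  rintro ⟨hk, e', he', hp', f', hf', hord, h'⟩
  obtain ⟨g, hg, hgz⟩ := F.transition e he e' he' p ⟨hp, hp'⟩
  have hd := deriv_transition_ne_zero he he' hp hp' hg hgz
  have heq := (HasCoeff.change h' he he' hp hp' hg hgz).eventuallyEq h he hp
  rw [hgz.self_of_nhds] at hf' hord
  have hcomp : MeromorphicAt (f' ∘ g) (e p).2 :=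
    (meromorphicAt_comp_iff_of_deriv_ne_zero hg hd).2 hf'
  refine ⟨hk, (hcomp.mul hg.deriv.meromorphicAt).congr heq, ?_⟩
  rw [← meromorphicOrderAt_congr heq, ← hord, ← meromorphicOrderAt_comp_of_deriv_ne_zero hg hd]
  have h0 : meromorphicOrderAt (deriv g) (e p).2 = 0 :=
    (hg.deriv.meromorphicNFAt.meromorphicOrderAt_eq_zero_iff).2 hd
  have := meromorphicOrderAt_mul hcomp hg.deriv.meromorphicAt
  rw [h0, add_zero] at this
  exact this

theorem HolomorphicAt.not_hasPoleAt (h : F.HolomorphicAt θ p) (k : ℕ) : ¬ F.HasPoleAt θ p k := by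
  obtain ⟨e, he, hp, f, hf, hθ⟩ := h
  have hc : HasCoeff θ p e f := hθ.mono fun q hq _ => hq
  rw [hc.hasPoleAt_iff he hp]
  rintro ⟨hk, -, hord⟩
  have h0 := hf.meromorphicOrderAt_nonneg
  rw [hord] at h0
  have : (0 : ℤ) ≤ -(k : ℤ) := by exact_mod_cast h0
  omega

end TransHolFoliation

namespace TransHolFoliation

variable {ℓ : ℕ} {M : Type*} [TopologicalSpace M]
  [ChartedSpace (EuclideanSpace ℝ (Fin (ℓ + 2))) M] {F : TransHolFoliation ℓ M}
  {e e' : OpenPartialHomeomorph M (FolModel ℓ)} {p q : M} {θ : ComplexOneForm ℓ M}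

/-! ### The leaf topology -/

theorem isOpen_leafTopology_levelSet (he : e ∈ F.atlas) (c : ℂ) :
    IsOpen[F.leafTopology] (e.source ∩ {q | (e q).2 = c}) :=
  TopologicalSpace.isOpen_generateFrom_of_mem ⟨e, he, univ, isOpen_univ, c, by ext; simp⟩

/-- Makes leafwise paths continuous in `M`, and closed sets of `M` closed for the leaf topology. -/
theorem leafTopology_le : F.leafTopology ≤ (inferInstance : TopologicalSpace M) := by
  intro O hO
  refine (@isOpen_iff_forall_mem_open M F.leafTopology O).2 fun q hq => ?_
  obtain ⟨e, he, hqe⟩ := F.cover q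
  have hsymm := e.symm.continuousAt (x := e q) (e.map_source hqe)
  rw [ContinuousAt, e.left_inv hqe] at hsymm
  obtain ⟨r, hr, hbox⟩ := Metric.mem_nhds_iff.1 (hsymm (hO.mem_nhds hq))
  rw [show e q = ((e q).1, (e q).2) from rfl, ← ball_prod_same] at hbox
  refine ⟨e.source ∩ e ⁻¹' (Metric.ball (e q).1 r ×ˢ {(e q).2}), ?_, ?_, ?_⟩
  · rintro a ⟨ha, ha1, ha2⟩
    have hmem : e a ∈ Metric.ball (e q).1 r ×ˢ Metric.ball (e q).2 r := by
      refine ⟨ha1, ?_⟩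
      rw [mem_singleton_iff.1 ha2]
      exact Metric.mem_ball_self hr
    have := hbox hmem
    rwa [mem_preimage, e.left_inv ha] at this
  · exact TopologicalSpace.isOpen_generateFrom_of_mem
      ⟨e, he, _, Metric.isOpen_ball, _, rfl⟩
  · exact ⟨hqe, Metric.mem_ball_self hr, rfl⟩

theorem continuous_of_leafTopology {γ : I → M} (hγ : @Continuous I M _ F.leafTopology γ) :
    Continuous γ :=
  continuous_le_rng leafTopology_le hγ

theorem eventually_transverse_eq_of_leafTopology {γ : I → M}
    (hγ : @Continuous I M _ F.leafTopology γ) (he : e ∈ F.atlas) {u : I} (hu : γ u ∈ e.source) :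
    ∀ᶠ t in 𝓝 u, γ t ∈ e.source ∧ (e (γ t)).2 = (e (γ u)).2 := by
  have h := @IsOpen.preimage I M _ F.leafTopology γ hγ _
    (isOpen_leafTopology_levelSet he (e (γ u)).2)
  exact h.mem_nhds ⟨hu, rfl⟩

/-- A compact leaf is, near each of its points, contained in a single plaque. -/
theorem IsCompactLeaf.eventually_transverse_eq [T2Space M] {L : Set M} (hL : F.IsCompactLeaf L)
    (he : e ∈ F.atlas) (hp : p ∈ e.source) :
    ∀ᶠ q in 𝓝 p, q ∈ L → (e q).2 = (e p).2 := by
  have : LocallyCompactSpace M :=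
    ChartedSpace.locallyCompactSpace (EuclideanSpace ℝ (Fin (ℓ + 2))) M
  obtain ⟨K, hKn, hKe, hK⟩ := local_compact_nhds (e.open_source.mem_nhds hp)
  -- Level sets of `z` are open in the leaf topology, so by compactness `z` takes finitely many
  -- values on `L ∩ K`; a neighbourhood of `z(p)` avoids all the others.
  have hKL : @IsCompact M F.leafTopology (L ∩ K) :=
    @IsCompact.inter_right M F.leafTopology _ _ hL.2 (hK.isClosed.mono leafTopology_le)
  obtain ⟨t, ht⟩ := @IsCompact.elim_finite_subcover M F.leafTopology _ ℂ hKL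
    (fun c => e.source ∩ {q | (e q).2 = c}) (fun c => isOpen_leafTopology_levelSet he c)
    (fun q hq => mem_iUnion.2 ⟨(e q).2, hKe hq.2, rfl⟩)
  have hfin : ((t : Set ℂ) \ {(e p).2})ᶜ ∈ 𝓝 (e p).2 :=
    (t.finite_toSet.sdiff).isClosed.isOpen_compl.mem_nhds (by simp)
  filter_upwards [hKn, (continuousAt_transverse hp) hfin] with q hqK hq hqL
  obtain ⟨c, hc, -, hqc⟩ := mem_iUnion₂.1 (ht ⟨hqL, hqK⟩)
  by_contra hne
  refine hq ⟨?_, hne⟩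
  change (e q).2 ∈ _
  rwa [show (e q).2 = c from hqc]

theorem IsFiniteUnionOfCompactLeaves.eventually_transverse_eq [T2Space M] {Λ : Set M}
    (hΛ : F.IsFiniteUnionOfCompactLeaves Λ) (he : e ∈ F.atlas) (hp : p ∈ e.source) :
    ∀ᶠ q in 𝓝 p, q ∈ Λ → (e q).2 = (e p).2 := by
  obtain ⟨S, hS, hSL, rfl⟩ := hΛ
  have h : ∀ᶠ q in 𝓝 p, ∀ L ∈ S, q ∈ L → (e q).2 = (e p).2 :=
    (eventually_all_finite hS).2 fun L hL => (hSL L hL).eventually_transverse_eq he hp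
  exact h.mono fun q hq ⟨L, hL, hqL⟩ => hq L hL hqL

/-! ### Transport of the coefficients along leaves -/

/-- Around each point of `Λ`, in each chart, `θ` has a coefficient, holomorphic without zeros off
the level set of the point. -/
def HasCoeffsAlong (F : TransHolFoliation ℓ M) (θ : ComplexOneForm ℓ M) (Λ : Set M) : Prop :=
  ∀ p ∈ Λ, ∀ e ∈ F.atlas, p ∈ e.source → ∃ f : ℂ → ℂ, HasCoeff θ p e f ∧
    ∀ᶠ c in 𝓝[≠] (e p).2, AnalyticAt ℂ f c ∧ f c ≠ 0

variable {Λ : Set M} {γ : I → M}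

theorem transverse_eq_of_slide (hγ : @Continuous I M _ F.leafTopology γ) (he : e ∈ F.atlas)
    {s t : I} (hst : s ≤ t) (hse : ∀ u ∈ Icc s t, γ u ∈ e.source) :
    (e (γ t)).2 = (e (γ s)).2 := by
  refine (isPreconnected_Icc.prop_iff_of_eventually (P := fun u => (e (γ u)).2 = (e (γ s)).2)
    (fun u hu => nhdsWithin_le_nhds ?_) (left_mem_Icc.2 hst) (right_mem_Icc.2 hst)).1 rfl
  exact (eventually_transverse_eq_of_leafTopology hγ he (hse u hu)).mono fun v hv => by rw [hv.2]

/-- Near `γ u` the path stays in one level set, where a single coefficient `f'` serves; that `f` is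
a coefficient there means only that it agrees with `f'` near the puncture, a condition constant in
`u`. -/
theorem HasCoeffsAlong.hasCoeff_of_slide (hC : F.HasCoeffsAlong θ Λ)
    (hγ : @Continuous I M _ F.leafTopology γ) (hγΛ : ∀ t, γ t ∈ Λ) (he : e ∈ F.atlas)
    {s t : I} (hst : s ≤ t) (hse : ∀ u ∈ Icc s t, γ u ∈ e.source) {f : ℂ → ℂ}
    (hf : HasCoeff θ (γ s) e f) : HasCoeff θ (γ t) e f := by
  refine (isPreconnected_Icc.prop_iff_of_eventually (P := fun u => HasCoeff θ (γ u) e f)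
    (fun u hu => nhdsWithin_le_nhds ?_) (left_mem_Icc.2 hst) (right_mem_Icc.2 hst)).1 hf
  obtain ⟨f', hf', -⟩ := hC (γ u) (hγΛ u) e he (hse u hu)
  filter_upwards [eventually_transverse_eq_of_leafTopology hγ he (hse u hu),
    (continuous_of_leafTopology hγ).continuousAt.eventually hf'.eventually_of_transverse_eq]
    with v hv h1
  have h2 := h1 hv.2
  refine ⟨fun h => hf'.congr (hse u hu) ?_, fun h => h2.congr hv.1 ?_⟩
  · exact hv.2 ▸ h2.eventuallyEq h he hv.1
  · exact hv.2 ▸ hf'.eventuallyEq h he (hse u hu)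

/-- The coefficient of `θ` is invariant under holonomy. -/
theorem HasCoeffsAlong.holonomy (hC : F.HasCoeffsAlong θ Λ)
    (hγ : @Continuous I M _ F.leafTopology γ) (hγΛ : ∀ t, γ t ∈ Λ)
    {e₀ : OpenPartialHomeomorph M (FolModel ℓ)} {f₀ : ℂ → ℂ} (hf₀ : HasCoeff θ (γ 0) e₀ f₀)
    {t : I} {h : ℂ → ℂ} (hol : F.HolonomyAlong γ e₀ t e h) :
    (e ∈ F.atlas ∧ γ t ∈ e.source) ∧ (AnalyticAt ℂ h (e₀ (γ 0)).2 ∧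
      h (e₀ (γ 0)).2 = (e (γ t)).2 ∧ deriv h (e₀ (γ 0)).2 ≠ 0) ∧
      ∃ f : ℂ → ℂ, HasCoeff θ (γ t) e f ∧
        ∀ᶠ c in 𝓝[≠] (e₀ (γ 0)).2, f (h c) * deriv h c = f₀ c := by
  induction hol with
  | start he h0 =>
    refine ⟨⟨he, h0⟩, ⟨analyticAt_id, rfl, by simp⟩, f₀, hf₀, Eventually.of_forall fun c => ?_⟩
    simp
  | slide _ hst hse ih =>
    obtain ⟨⟨he, -⟩, ⟨hh, hz, hd⟩, f, hf, hinv⟩ := ih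
    refine ⟨⟨he, hse _ (right_mem_Icc.2 hst)⟩, ⟨hh, ?_, hd⟩, f,
      hC.hasCoeff_of_slide hγ hγΛ he hst hse hf, hinv⟩
    rw [hz, transverse_eq_of_slide hγ he hst hse]
  | @change t e e' h g _ he' hp' hg hgz ih =>
    obtain ⟨⟨he, hp⟩, ⟨hh, hz, hd⟩, f, hf, hinv⟩ := ih
    obtain ⟨f', hf', -⟩ := hC _ (hγΛ t) e' he' hp'
    have hgd := deriv_transition_ne_zero he he' hp hp' hg hgz
    have heq := (hf'.change he he' hp hp' hg hgz).eventuallyEq hf he hp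
    rw [← hz] at hg hgd heq
    have hdc : ∀ c, AnalyticAt ℂ h c → AnalyticAt ℂ g (h c) →
        deriv (g ∘ h) c = deriv g (h c) * deriv h c := fun c h1 h2 =>
      deriv_comp c h2.differentiableAt h1.differentiableAt
    refine ⟨⟨he', hp'⟩, ⟨hg.comp hh, ?_, ?_⟩, f', hf', ?_⟩
    · rw [Function.comp_apply, hz, hgz.self_of_nhds]
    · rw [hdc _ hh hg]
      exact mul_ne_zero hgd hd
    -- Coefficients agree only off the centre, so `h` must preserve punctured neighbourhoods; this
    -- is where `h' ≠ 0` enters.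
    · have hto : Tendsto h (𝓝[≠] (e₀ (γ 0)).2) (𝓝[≠] (h (e₀ (γ 0)).2)) :=
        tendsto_nhdsWithin_iff.2 ⟨hh.continuousAt.mono_left nhdsWithin_le_nhds,
          hh.differentiableAt.hasDerivAt.eventually_ne hd⟩
      filter_upwards [hinv, hto.eventually heq,
        hh.eventually_analyticAt.filter_mono nhdsWithin_le_nhds,
        (hh.continuousAt.eventually hg.eventually_analyticAt).filter_mono nhdsWithin_le_nhds]
        with c h1 h2 h3 h4
      rw [hdc c h3 h4, ← mul_assoc, Function.comp_apply, h2, h1]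

/-- Nearby points of the path share both the coefficient and the value of `z`, so the pole order is
locally constant. -/
theorem HasCoeffsAlong.hasPoleAt_iff (hC : F.HasCoeffsAlong θ Λ)
    (hγ : @Continuous I M _ F.leafTopology γ) (hγΛ : ∀ t, γ t ∈ Λ) (k : ℕ) (s t : I) :
    F.HasPoleAt θ (γ s) k ↔ F.HasPoleAt θ (γ t) k := by
  refine IsPreconnected.prop_iff_of_eventually (s := Icc 0 1)
    (P := fun u => F.HasPoleAt θ (γ u) k) isPreconnected_Icc (fun u _ => nhdsWithin_le_nhds ?_)
    ⟨bot_le, le_top⟩ ⟨bot_le, le_top⟩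
  obtain ⟨e, he, hu⟩ := F.cover (γ u)
  obtain ⟨f, hf, -⟩ := hC (γ u) (hγΛ u) e he hu
  filter_upwards [eventually_transverse_eq_of_leafTopology hγ he hu,
    (continuous_of_leafTopology hγ).continuousAt.eventually hf.eventually_of_transverse_eq]
    with v hv h1
  rw [hf.hasPoleAt_iff he hu, (h1 hv.2).hasPoleAt_iff he hv.1, hv.2]

/-- Along a leaf whose holonomy contains an attractor, `θ` has a simple pole. -/
theorem HasCoeffsAlong.hasPoleAt_one (hC : F.HasCoeffsAlong θ Λ) {L : Set M} (hL : F.IsLeaf L)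
    (hLΛ : L ⊆ Λ) (hatt : F.HasAttractor L) (hq : q ∈ L) : F.HasPoleAt θ q 1 := by
  obtain ⟨p, hpL, e, he, hp, h, ⟨γ, hγ, h0, h1, hol⟩, hh⟩ := hatt
  obtain ⟨b, rfl⟩ := hL
  have hpath : ∀ {γ : I → M}, @Continuous I M _ F.leafTopology γ → γ 0 = p → ∀ t, γ t ∈ Λ := by
    intro γ hγ h0 t
    refine hLΛ ?_
    have h2 := @Continuous.mem_pathComponent_zero M F.leafTopology γ hγ t
    rw [h0] at h2
    exact @Joined.trans M F.leafTopology _ _ _ hpL h2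
  have hpole : F.HasPoleAt θ p 1 := by
    obtain ⟨f, hf, hfan⟩ := hC p (hLΛ hpL) e he hp
    obtain ⟨-, ⟨hhan, hz, hd⟩, f', hf', hinv⟩ :=
      hC.holonomy hγ (hpath hγ h0) (h0.symm ▸ hf) hol
    rw [h0] at hhan hz hd hinv
    rw [h1] at hz hf'
    have hto : Tendsto h (𝓝[≠] (e p).2) (𝓝[≠] (e p).2) := by
      refine tendsto_nhdsWithin_iff.2 ⟨?_, hhan.differentiableAt.hasDerivAt.eventually_ne hd⟩
      have := hhan.continuousAt.mono_left (nhdsWithin_le_nhds (s := {(e p).2}ᶜ))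
      rwa [hz] at this
    -- The loop ends at `p` in the initial chart, so the transported coefficient `f'` agrees with
    -- `f` near the puncture.
    have hinv' : ∀ᶠ c in 𝓝[≠] (e p).2, f (h c) * deriv h c = f c := by
      filter_upwards [hinv, hto.eventually (hf.eventuallyEq hf' he hp)] with c h2 h3
      rw [h3, h2]
    rw [hf.hasPoleAt_iff he hp]
    exact ⟨le_rfl, meromorphicOrderAt_eq_neg_one_of_invariant hfan hhan hz hd
      (hh.norm_deriv_lt_one hhan) hinv'⟩
  obtain ⟨δ, hδ, hδ0, hδ1⟩ := @Joined.exists_continuous M F.leafTopology _ _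
    (@Joined.trans M F.leafTopology _ _ _ (@Joined.symm M F.leafTopology _ _ hpL) hq)
  have := hC.hasPoleAt_iff hδ (hpath hδ hδ0) 1 0 1
  rw [hδ0, hδ1] at this
  exact this.1 hpole

/-! ### Logarithmic forms and additive structures -/

theorem IsFiniteUnionOfCompactLeaves.logarithmicOn [T2Space M]
    (hΛ : F.IsFiniteUnionOfCompactLeaves Λ)
    (hattr : ∀ L : Set M, F.IsLeaf L → L ⊆ Λ → F.HasAttractor L) {W : Set M} (hW : IsOpen W)
    (hΛW : Λ ⊆ W) (hθ : F.HolomorphicOn θ (W \ Λ)) (hcl : F.ClosedOn θ (W \ Λ))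
    (hdef : F.DefinedBy θ (W \ Λ)) : F.LogarithmicOn θ W Λ := by
  have hC : F.HasCoeffsAlong θ Λ := by
    intro p hpΛ e he hp
    refine exists_hasCoeff hθ hdef he hp ?_
    filter_upwards [hΛ.eventually_transverse_eq he hp, hW.mem_nhds (hΛW hpΛ)] with q h1 h2 h3
    exact ⟨h2, fun h4 => h3 (h1 h4)⟩
  have hpole : ∀ p ∈ Λ, F.HasPoleAt θ p 1 := by
    obtain ⟨S, -, hSL, rfl⟩ := hΛ
    rintro p ⟨L, hL, hpL⟩
    have hLΛ := subset_sUnion_of_mem hL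
    exact hC.hasPoleAt_one (hSL L hL).1 hLΛ (hattr L (hSL L hL).1 hLΛ) hpL
  refine ⟨fun p hp => ?_, ?_, hpole, hcl, hdef⟩
  · by_cases hpΛ : p ∈ Λ
    · exact Or.inr ⟨1, hpole p hpΛ⟩
    · exact Or.inl (hθ p ⟨hp, hpΛ⟩)
  · refine Subset.antisymm ?_ fun p hp => ⟨⟨1, hpole p hp⟩, hΛW hp⟩
    rintro p ⟨⟨k, hk⟩, hpW⟩
    by_contra hpΛ
    exact (hθ p ⟨hpW, hpΛ⟩).not_hasPoleAt k hk

/-- The differentials of the charts of an additive transverse structure agree on overlaps. -/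
theorem IsAdditiveAtlasOn.exists_form {O : Set M} {ι : Type*} {U : ι → Set M} {y : ι → M → ℂ}
    (h : F.IsAdditiveAtlasOn O U y) : ∃ θ : ComplexOneForm ℓ M,
      (∀ i, ∀ p ∈ U i, θ p = differential ℓ (y i) p) ∧ F.HolomorphicOn θ O ∧
        F.DefinedBy θ O := by
  classical
  let θ : ComplexOneForm ℓ M := fun p =>
    if hp : ∃ i, p ∈ U i then differential ℓ (y hp.choose) p else 0
  have hθ : ∀ i, ∀ p ∈ U i, θ p = differential ℓ (y i) p := by
    intro i p hp
    have hex : ∃ i, p ∈ U i := ⟨i, hp⟩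
    obtain ⟨a, ha⟩ := h.transition hex.choose i p ⟨hex.choose_spec, hp⟩
    have hy : MDifferentiableAt (𝓡 (ℓ + 2)) 𝓘(ℝ, ℂ) (y i) p := by
      obtain ⟨e, he, hpe, g, hg, hgy⟩ := h.holomorphic i p hp
      have h1 : MDifferentiableAt (𝓡 (ℓ + 2)) 𝓘(ℝ, ℂ) (g ∘ fun q => (e q).2) p :=
        (hg.differentiableAt.restrictScalars ℝ).mdifferentiableAt.comp p
          (mdifferentiableAt_transverse he hpe)
      exact h1.congr_of_eventuallyEq hgy
    have h2 : y hex.choose =ᶠ[𝓝 p] (y i + fun _ => a) := ha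
    have h3 : θ p = differential ℓ (y hex.choose) p := dif_pos hex
    rw [h3]
    unfold differential
    rw [h2.mfderiv_eq, mfderiv_add hy mdifferentiableAt_const, mfderiv_const]
    exact add_zero _
  refine ⟨θ, hθ, fun p hp => ?_, fun p hp => ?_⟩
  · obtain ⟨i, hi⟩ := mem_iUnion.1 (h.cover.symm ▸ hp)
    refine (h.holomorphic i p hi).holomorphicAt_differential.congr ?_
    filter_upwards [(h.isOpen i).mem_nhds hi] with q hq using hθ i q hq
  · obtain ⟨i, hi⟩ := mem_iUnion.1 (h.cover.symm ▸ hp)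
    rw [hθ i p hi]
    exact h.definedBy i p hi

end TransHolFoliation

theorem mainTheorem8 {ℓ : ℕ} {M : Type*} [TopologicalSpace M] [T2Space M]
    [ChartedSpace (EuclideanSpace ℝ (Fin (ℓ + 2))) M] [IsManifold (𝓡 (ℓ + 2)) ∞ M]
    (F : TransHolFoliation ℓ M) (Λ : Set M) (hΛ : F.IsFiniteUnionOfCompactLeaves Λ)
    (hattr : ∀ L : Set M, F.IsLeaf L → L ⊆ Λ → F.HasAttractor L) :
    (∀ (W : Set M) (θ : ComplexOneForm ℓ M), IsOpen W → Λ ⊆ W →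
        F.HolomorphicOn θ (W \ Λ) → F.ClosedOn θ (W \ Λ) → F.DefinedBy θ (W \ Λ) →
        ∃ η : ComplexOneForm ℓ M, (∀ p ∈ W \ Λ, η p = θ p) ∧ F.LogarithmicOn η W Λ) ∧
    (∀ {ι : Type*} (U : ι → Set M) (y : ι → M → ℂ), F.IsAdditiveAtlasOn Λᶜ U y →
        ∃ θ : ComplexOneForm ℓ M, (∀ i, ∀ p ∈ U i, θ p = differential ℓ (y i) p) ∧
          F.LogarithmicOn θ univ Λ) := by
  -- The form is its own extension, since its values on the polar set play no role.
  refine ⟨fun W θ hW hΛW hθ hcl hdef => ⟨θ, fun _ _ => rfl,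
    hΛ.logarithmicOn hattr hW hΛW hθ hcl hdef⟩, fun U y hy => ?_⟩
  obtain ⟨θ, hθy, hθ, hdef⟩ := hy.exists_form
  rw [compl_eq_univ_sdiff] at hθ hdef
  exact ⟨θ, hθy, hΛ.logarithmicOn hattr isOpen_univ (subset_univ _) hθ hθ.closedOn hdef⟩
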